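/- All topological groups are assumed Hausdorff. A point $x$ of a space $X$ is a *pseudocompactness point* if there is a sequence $(U_n)_{n\in\omega}$ of open neighborhoods of $x$ such that for every sequence $(V_n)_{n\in\omega}$ of non-empty open sets of $X$ with $V_n\subseteq U_n$ for all $n$ there is a point $y\in X$ each neighborhood of which meets $V_n$ for infinitely many $n$. A set $A\subseteq X$ is *$r$-pseudocompact in $X$* if for every infinite family $\gamma$ of open sets of $X$, each of which meets $A$, there is a point $a\in A$ each neighborhood of which meets infinitely many members of $\gamma$. **Theorem.** Let $G$ be a topological group which has a pseudocompactness point, let $H$ be a closed subgroup of $G$, and let $G/H$ be the space of left cosets with the quotient topology. Then there are a metrizable space $M$ and a continuous open map $f$ from $G/H$ onto $M$ such that $f^{-1}(F)$ is $r$-pseudocompact in $G/H$ for every set $F\subseteq M$ that is $r$-pseudocompact in $M$. -/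

import Mathlib

open Set Topology

universe u

/-- `x` is a point of accumulation of the sequence of sets `V`: every neighborhood of `x` meets
`V n` for infinitely many indices `n`. -/
def IsSeqAccPoint {X : Type*} [TopologicalSpace X] (V : ℕ → Set X) (x : X) : Prop :=
  ∀ W ∈ 𝓝 x, {n : ℕ | (W ∩ V n).Nonempty}.Infinite

/-- `x` is a pseudocompactness point of `X`: there are open neighborhoods `U n` of `x` such that
every sequence of non-empty open sets `V n ⊆ U n` has a point of accumulation in `X`. -/
def IsPseudocompactnessPoint {X : Type*} [TopologicalSpace X] (x : X) : Prop :=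
  ∃ U : ℕ → Set X, (∀ n, IsOpen (U n) ∧ x ∈ U n) ∧
    ∀ V : ℕ → Set X, (∀ n, IsOpen (V n) ∧ (V n).Nonempty ∧ V n ⊆ U n) →
      ∃ y : X, IsSeqAccPoint V y

/-- `x` is an accumulation point of the family of sets `γ`: every neighborhood of `x` meets
infinitely many members of `γ`. -/
def IsFamilyAccPoint {X : Type*} [TopologicalSpace X] (γ : Set (Set X)) (x : X) : Prop :=
  ∀ W ∈ 𝓝 x, {U ∈ γ | (W ∩ U).Nonempty}.Infinite

/-- `A` is `r`-pseudocompact in `X`: every infinite family of open sets of `X`, each of which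
meets `A`, has an accumulation point lying in `A`. -/
def IsRPseudocompact {X : Type*} [TopologicalSpace X] (A : Set X) : Prop :=
  ∀ γ : Set (Set X), γ.Infinite → (∀ U ∈ γ, IsOpen U ∧ (U ∩ A).Nonempty) →
    ∃ a ∈ A, IsFamilyAccPoint γ a

open Filter
open scoped Pointwise Uniformity

/-! By homogeneity `1` is a pseudocompactness point. Shrink its neighborhoods to symmetric open `O
n` with `O (n + 1)` squared inside `O n`, and put `K = ⋂ n, O n`. The relations `x * y⁻¹ ∈ O n`
generate a countably based uniformity on `G ⧸ H`; its separation quotient is the metrizable `M`, and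
left translation by `K` preserves the fibers of the projection.

Everything rests on one fact: open sets `V n ⊆ O n` accumulate, and only at points of `K`. It yields
`O n ⊆ K * A` for some `n`, for each neighborhood `A` of `1`, hence openness of the projection. It
also lifts a cluster point in `M` to an accumulation point in the fiber above it. -/

/-- A decreasing sequence of symmetric open neighborhoods of `1`, each containing the square of its
successor. -/
structure IsSquareRootSequence {G : Type*} [Group G] [TopologicalSpace G] (O : ℕ → Set G) :
    Prop where
  isOpen : ∀ n, IsOpen (O n)
  one_mem : ∀ n, (1 : G) ∈ O n
  inv_mem : ∀ n, ∀ x ∈ O n, x⁻¹ ∈ O n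
  mul_mem : ∀ n, ∀ x ∈ O (n + 1), ∀ y ∈ O (n + 1), x * y ∈ O n

theorem exists_isOpen_symm_mul_subset {G : Type*} [Group G] [TopologicalSpace G]
    [IsTopologicalGroup G] {A : Set G} (hA : A ∈ 𝓝 (1 : G)) :
    ∃ B : Set G, IsOpen B ∧ (1 : G) ∈ B ∧ (∀ x ∈ B, x⁻¹ ∈ B) ∧
      ∀ x ∈ B, ∀ y ∈ B, x * y ∈ A := by
  obtain ⟨V, hVo, hV1, hV⟩ := exists_open_nhds_one_mul_subset hA
  refine ⟨V ∩ V⁻¹, hVo.inter hVo.inv, ⟨hV1, by simpa using hV1⟩, ?_, ?_⟩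
  · rintro x ⟨h1, h2⟩
    exact ⟨h2, by simpa using h1⟩
  · rintro x ⟨h1, -⟩ y ⟨h2, -⟩
    exact hV (Set.mul_mem_mul h1 h2)

theorem exists_isSquareRootSequence {G : Type*} [Group G] [TopologicalSpace G]
    [IsTopologicalGroup G] (U : ℕ → Set G) (hU : ∀ n, U n ∈ 𝓝 (1 : G)) :
    ∃ O : ℕ → Set G, IsSquareRootSequence O ∧ ∀ n, O n ⊆ U n := by
  choose B hBo hB1 hBi hBm using
    fun A : {A : Set G // A ∈ 𝓝 (1 : G)} => exists_isOpen_symm_mul_subset A.2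
  have hB : ∀ A, B A ∈ 𝓝 (1 : G) := fun A => (hBo A).mem_nhds (hB1 A)
  have hBs : ∀ A, B A ⊆ A.1 := fun A x hx => by simpa using hBm A x hx 1 (hB1 A)
  let S : ℕ → {A : Set G // A ∈ 𝓝 (1 : G)} := fun n =>
    Nat.rec ⟨U 0, hU 0⟩ (fun n A => ⟨B A ∩ U (n + 1), inter_mem (hB A) (hU (n + 1))⟩) n
  have hS : ∀ n, (S (n + 1)).1 = B (S n) ∩ U (n + 1) := fun n => rfl
  refine ⟨fun n => B (S n), ⟨fun n => hBo _, fun n => hB1 _, fun n => hBi _, ?_⟩, ?_⟩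
  · intro n x hx y hy
    have := hBm _ x hx y hy
    rw [hS] at this
    exact this.1
  · intro n x hx
    have := hBs _ hx
    cases n with
    | zero => exact this
    | succ n => rw [hS] at this; exact this.2

theorem IsRPseudocompact.exists_mapClusterPt {M : Type*} [TopologicalSpace M]
    [TopologicalSpace.MetrizableSpace M] {F : Set M} (hF : IsRPseudocompact F) {x : ℕ → M}
    (hx : ∀ n, x n ∈ F) : ∃ a ∈ F, MapClusterPt a atTop x := by
  let _ := TopologicalSpace.metrizableSpaceMetric M
  have hpos : ∀ n : ℕ, (0 : ℝ) < 1 / (n + 1) := fun n => Nat.one_div_pos_of_nat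
  have hball : ∀ n : ℕ, x n ∈ Metric.ball (x n) (1 / (n + 1)) := fun n =>
    Metric.mem_ball_self (hpos n)
  let γ : Set (Set M) := range fun n : ℕ => Metric.ball (x n) (1 / (n + 1))
  have key : ∀ a : M, (∀ ε > 0, ∃ᶠ n in atTop, ∃ w ∈ Metric.ball (x n) (1 / ((n : ℝ) + 1)),
      dist w a < ε) → MapClusterPt a atTop x := by
    intro a ha
    refine Metric.nhds_basis_ball.mapClusterPt_iff_frequently.2 fun ε hε => ?_
    have hev : ∀ᶠ n : ℕ in atTop, (1 : ℝ) / (n + 1) < ε / 2 :=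
      tendsto_one_div_add_atTop_nhds_zero_nat.eventually (gt_mem_nhds (half_pos hε))
    refine ((ha (ε / 2) (half_pos hε)).and_eventually hev).mono ?_
    rintro n ⟨⟨w, hw, hwa⟩, hn⟩
    have := dist_triangle_left (x n) a w
    rw [Metric.mem_ball] at hw ⊢
    linarith
  -- A finite `γ` says nothing about accumulation, but then one ball recurs infinitely often. Its
  -- radii bounds shrink to `0`, so its first center is a cluster point.
  rcases γ.finite_or_infinite with hfin | hinf
  · obtain ⟨m, hm⟩ : ∃ m : ℕ, {n : ℕ | Metric.ball (x n) (1 / ((n : ℝ) + 1)) =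
        Metric.ball (x m) (1 / ((m : ℝ) + 1))}.Infinite := by
      by_contra! hcon
      refine Set.infinite_univ ((hfin.preimage' ?_).subset fun n _ => mem_range_self n)
      rintro _ ⟨m, rfl⟩
      exact hcon m
    refine ⟨x m, hx m, key _ fun ε hε => (Nat.frequently_atTop_iff_infinite.2 hm).mono ?_⟩
    intro n hn
    exact ⟨x m, hn ▸ hball m, by simpa using hε⟩
  · obtain ⟨a, haF, ha⟩ := hF γ hinf (by
      rintro _ ⟨n, rfl⟩
      exact ⟨Metric.isOpen_ball, x n, hball n, hx n⟩)
    refine ⟨a, haF, key a fun ε hε => Nat.frequently_atTop_iff_infinite.2 ?_⟩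
    refine Set.Infinite.of_image (fun n : ℕ => Metric.ball (x n) (1 / (n + 1)))
      ((ha _ (Metric.ball_mem_nhds a hε)).mono ?_)
    rintro _ ⟨⟨n, rfl⟩, w, hwa, hw⟩
    exact ⟨n, ⟨w, hw, hwa⟩, rfl⟩

/-! ### The uniformity on the coset space. -/

/-- The entourage of pairs `(xH, yH)` with `x * y⁻¹ ∈ A`. -/
def cosetEntourage {G : Type*} [Group G] (H : Subgroup G) (A : Set G) : Set ((G ⧸ H) × (G ⧸ H)) :=
  {p | ∃ x y : G, (x : G ⧸ H) = p.1 ∧ (y : G ⧸ H) = p.2 ∧ x * y⁻¹ ∈ A}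

/-- Right multiplication of both representatives by the same element of `H` leaves `x * y⁻¹`
unchanged, so the second one may be prescribed. This is what lets entourages compose. -/
theorem mem_cosetEntourage_mk_right {G : Type*} [Group G] {H : Subgroup G} {A : Set G} {p : G ⧸ H} {g : G} :
    (p, (g : G ⧸ H)) ∈ cosetEntourage H A ↔ ∃ x : G, (x : G ⧸ H) = p ∧ x * g⁻¹ ∈ A := by
  constructor
  · rintro ⟨x, y, rfl, hy, hxy⟩
    have hy' : g⁻¹ * y ∈ H := QuotientGroup.eq.1 hy.symm
    refine ⟨x * (g⁻¹ * y)⁻¹, ?_, ?_⟩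
    · exact QuotientGroup.mk_mul_of_mem x (H.inv_mem hy')
    · convert hxy using 1
      group
  · rintro ⟨x, rfl, hx⟩
    exact ⟨x, g, rfl, rfl, hx⟩

namespace IsSquareRootSequence

variable {G : Type*} [Group G] [TopologicalSpace G] {O : ℕ → Set G}

theorem antitone (hO : IsSquareRootSequence O) : Antitone O :=
  antitone_nat_of_succ_le fun n x hx => by simpa using hO.mul_mem n x hx 1 (hO.one_mem _)

theorem mem_iInter_of_isSeqAccPoint [IsTopologicalGroup G] (hO : IsSquareRootSequence O)
    {V : ℕ → Set G} (hV : ∀ n, V n ⊆ O n) {y : G} (hy : IsSeqAccPoint V y) : y ∈ ⋂ n, O n := by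
  refine mem_iInter.2 fun m => ?_
  have hW : (fun z => z * y⁻¹) ⁻¹' O (m + 1) ∈ 𝓝 y :=
    ((hO.isOpen _).preimage (continuous_mul_const _)).mem_nhds (by simpa using hO.one_mem _)
  obtain ⟨n, ⟨v, hv, hvV⟩, hn⟩ := (hy _ hW).exists_gt m
  have h := hO.mul_mem m _ (hO.inv_mem _ _ hv) v (hO.antitone (Nat.succ_le_of_lt hn) (hV n hvV))
  simpa using h

/-- If sequences of non-empty open sets `V n ⊆ O n` accumulate, then the `O n` are a base at the
intersection `K = ⋂ n, O n` modulo left translations by `K`. -/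
theorem exists_subset_iInter_mul [IsTopologicalGroup G] (hO : IsSquareRootSequence O)
    (hacc : ∀ V : ℕ → Set G, (∀ n, IsOpen (V n) ∧ (V n).Nonempty ∧ V n ⊆ O n) →
      ∃ y, IsSeqAccPoint V y) {A : Set G} (hA : A ∈ 𝓝 (1 : G)) :
    ∃ n, O n ⊆ (⋂ n, O n) * A := by
  obtain ⟨B, hBo, hB1, hBi, hBm⟩ := exists_isOpen_symm_mul_subset hA
  by_contra! hcon
  choose z hzO hzA using fun n => not_subset.1 (hcon n)
  have hopen : ∀ x : G, IsOpen ((fun w => x⁻¹ * w) ⁻¹' B) := fun x =>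
    hBo.preimage (continuous_const_mul _)
  have hVO : ∀ n, O n ∩ (fun w => (z n)⁻¹ * w) ⁻¹' B ⊆ O n := fun n => inter_subset_left
  -- If `y` is an accumulation point of the sets `O n ∩ z n * B`, then `y * B` meets some `z n * B`,
  -- so `z n ∈ y * B * B⁻¹ ⊆ K * A`, a contradiction.
  obtain ⟨y, hy⟩ := hacc (fun n => O n ∩ (fun w => (z n)⁻¹ * w) ⁻¹' B) fun n =>
    ⟨(hO.isOpen n).inter (hopen _), ⟨z n, hzO n, by simpa using hB1⟩, hVO n⟩
  have hyK := hO.mem_iInter_of_isSeqAccPoint hVO hy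
  obtain ⟨n, w, hw, -, hwz⟩ :=
    (hy _ ((hopen y).mem_nhds (by simpa using hB1))).nonempty
  refine hzA n (Set.mem_mul.2 ⟨y, hyK, _, hBm _ hw _ (hBi _ hwz), ?_⟩)
  group

theorem hasBasis_cosetEntourage (hO : IsSquareRootSequence O) (H : Subgroup G) :
    (⨅ n, 𝓟 (cosetEntourage H (O n))).HasBasis (fun _ => True) fun n => cosetEntourage H (O n) := by
  refine hasBasis_iInf_principal (Antitone.directed_ge fun m n hmn => ?_)
  rintro p ⟨x, y, hx, hy, hxy⟩
  exact ⟨x, y, hx, hy, hO.antitone hmn hxy⟩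

/-- The uniformity on `G ⧸ H` generated by the entourages of the sets `O n`. -/
def cosetCore (hO : IsSquareRootSequence O) (H : Subgroup G) : UniformSpace.Core (G ⧸ H) :=
  UniformSpace.Core.mkOfBasis (hO.hasBasis_cosetEntourage H).isBasis.filterBasis
    (by
      rintro _ ⟨n, -, rfl⟩ p
      obtain ⟨x, rfl⟩ := QuotientGroup.mk_surjective p
      exact ⟨x, x, rfl, rfl, by simpa using hO.one_mem n⟩)
    (by
      rintro _ ⟨n, -, rfl⟩
      refine ⟨_, ⟨n, trivial, rfl⟩, ?_⟩
      rintro ⟨p, q⟩ ⟨x, y, hx, hy, hxy⟩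
      exact ⟨y, x, hy, hx, by simpa using hO.inv_mem n _ hxy⟩)
    (by
      rintro _ ⟨n, -, rfl⟩
      refine ⟨_, ⟨n + 1, trivial, rfl⟩, ?_⟩
      rintro ⟨p, r⟩ ⟨q, hpq, y, z, hy, hz, hyz⟩
      obtain rfl : (y : G ⧸ H) = q := hy
      obtain ⟨x, hx, hxy⟩ := mem_cosetEntourage_mk_right.1 hpq
      exact ⟨x, z, hx, hz, by simpa [mul_assoc] using hO.mul_mem n _ hxy _ hyz⟩)

/-- A copy of `G ⧸ H` carrying the uniformity generated by the entourages of the sets `O n`. -/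
def CosetSpace (_ : IsSquareRootSequence O) (H : Subgroup G) := G ⧸ H

/-- The identity map from `G ⧸ H` to its copy. -/
def toCosetSpace (hO : IsSquareRootSequence O) (H : Subgroup G) (p : G ⧸ H) : hO.CosetSpace H := p

instance (hO : IsSquareRootSequence O) (H : Subgroup G) : UniformSpace (hO.CosetSpace H) :=
  .ofCore (hO.cosetCore H)

theorem hasBasis_uniformity (hO : IsSquareRootSequence O) (H : Subgroup G) :
    (𝓤 (hO.CosetSpace H)).HasBasis (fun _ => True) fun n => cosetEntourage H (O n) := by
  refine (FilterBasis.hasBasis (hO.hasBasis_cosetEntourage H).isBasis.filterBasis).to_hasBasis ?_ ?_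
  · rintro _ ⟨n, -, rfl⟩
    exact ⟨n, trivial, Subset.rfl⟩
  · exact fun n _ => ⟨_, ⟨n, trivial, rfl⟩, Subset.rfl⟩

instance (hO : IsSquareRootSequence O) (H : Subgroup G) :
    (𝓤 (hO.CosetSpace H)).IsCountablyGenerated :=
  (hO.hasBasis_uniformity H).isCountablyGenerated

/-! ### The metrizable quotient and its projection. -/

/-- The metrizable quotient of `G ⧸ H` associated with the sequence `O`. -/
abbrev CosetQuotient (hO : IsSquareRootSequence O) (H : Subgroup G) :=
  SeparationQuotient (hO.CosetSpace H)

instance (hO : IsSquareRootSequence O) (H : Subgroup G) :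
    TopologicalSpace.MetrizableSpace (hO.CosetQuotient H) :=
  have : (𝓤 (hO.CosetQuotient H)).IsCountablyGenerated := by
    rw [SeparationQuotient.uniformity_eq]
    infer_instance
  UniformSpace.metrizableSpace

/-- The projection of `G ⧸ H` onto its metrizable quotient. -/
def proj (hO : IsSquareRootSequence O) (H : Subgroup G) (p : G ⧸ H) : hO.CosetQuotient H :=
  SeparationQuotient.mk (hO.toCosetSpace H p)

theorem proj_surjective (hO : IsSquareRootSequence O) (H : Subgroup G) :
    Function.Surjective (hO.proj H) :=
  SeparationQuotient.surjective_mk (X := hO.CosetSpace H)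

theorem nhds_proj_hasBasis (hO : IsSquareRootSequence O) (H : Subgroup G) (g : G) :
    (𝓝 (hO.proj H g)).HasBasis (fun _ => True)
      fun n => hO.proj H '' {p | (p, (g : G ⧸ H)) ∈ cosetEntourage H (O n)} := by
  have h := (nhds_basis_uniformity (hO.hasBasis_uniformity H) (x := hO.toCosetSpace H g)).map
    (SeparationQuotient.mk (X := hO.CosetSpace H))
  rwa [SeparationQuotient.map_mk_nhds] at h

theorem eventually_of_proj_tendsto (hO : IsSquareRootSequence O) (H : Subgroup G) (g : G) (n : ℕ) :
    ∀ᶠ q in 𝓝 (hO.proj H g), ∀ p, hO.proj H p = q → (p, (g : G ⧸ H)) ∈ cosetEntourage H (O n) := by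
  have h := nhds_basis_uniformity (hO.hasBasis_uniformity H) (x := hO.toCosetSpace H g)
  have := (SeparationQuotient.comap_mk_nhds_mk (X := hO.CosetSpace H) (x := hO.toCosetSpace H g)).le
    (h.mem_of_mem (i := n) trivial)
  obtain ⟨t, ht, hts⟩ := mem_comap.1 this
  filter_upwards [ht] with q hq p hp
  subst hp
  exact @hts (hO.toCosetSpace H p) hq

theorem proj_mul_left (hO : IsSquareRootSequence O) (H : Subgroup G) {k : G}
    (hk : k ∈ ⋂ n, O n) (g : G) : hO.proj H (k * g : G) = hO.proj H g := by
  refine (SeparationQuotient.mk_eq_mk (X := hO.CosetSpace H)).2 ?_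
  refine (hO.hasBasis_uniformity H).inseparable_iff_uniformity.2 fun n _ => ?_
  exact mem_cosetEntourage_mk_right.2 ⟨k * g, rfl, by simpa using mem_iInter.1 hk n⟩

theorem continuous_proj [IsTopologicalGroup G] (hO : IsSquareRootSequence O) (H : Subgroup G) :
    Continuous (hO.proj H) := by
  refine (QuotientGroup.isQuotientMap_mk H).continuous_iff.2 (continuous_iff_continuousAt.2 fun g => ?_)
  refine (hO.nhds_proj_hasBasis H g).ge_iff.2 fun n _ => ?_
  have : (fun z => z * g⁻¹) ⁻¹' O n ∈ 𝓝 g :=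
    ((hO.isOpen n).preimage (continuous_mul_const _)).mem_nhds (by simpa using hO.one_mem n)
  refine mem_map.2 (mem_of_superset this fun z hz => ?_)
  exact ⟨z, mem_cosetEntourage_mk_right.2 ⟨z, rfl, hz⟩, rfl⟩

theorem isOpenMap_proj [IsTopologicalGroup G] (hO : IsSquareRootSequence O)
    (hacc : ∀ V : ℕ → Set G, (∀ n, IsOpen (V n) ∧ (V n).Nonempty ∧ V n ⊆ O n) →
      ∃ y, IsSeqAccPoint V y) (H : Subgroup G) :
    IsOpenMap (hO.proj H) := by
  refine fun W hW => isOpen_iff_mem_nhds.2 ?_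
  rintro _ ⟨p, hp, rfl⟩
  obtain ⟨g, rfl⟩ := QuotientGroup.mk_surjective p
  have hA : (fun z : G => ((z * g : G) : G ⧸ H)) ⁻¹' W ∈ 𝓝 (1 : G) :=
    (hW.preimage (QuotientGroup.continuous_mk.comp (continuous_mul_const g))).mem_nhds
      (by simpa using hp)
  obtain ⟨n, hn⟩ := hO.exists_subset_iInter_mul hacc hA
  refine (hO.nhds_proj_hasBasis H g).mem_iff.2 ⟨n, trivial, ?_⟩
  rintro _ ⟨q, hq, rfl⟩
  obtain ⟨x, rfl, hx⟩ := mem_cosetEntourage_mk_right.1 hq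
  obtain ⟨k, hk, o, ho, hko⟩ := Set.mem_mul.1 (hn hx)
  -- The point `o * g` lies over `W`, and `x = k * o * g` has the same projection because `k ∈ K`.
  refine ⟨_, ho, ?_⟩
  rw [← hO.proj_mul_left H hk, ← mul_assoc, hko, inv_mul_cancel_right]

theorem isRPseudocompact_preimage_proj [IsTopologicalGroup G] (hO : IsSquareRootSequence O)
    (hacc : ∀ V : ℕ → Set G, (∀ n, IsOpen (V n) ∧ (V n).Nonempty ∧ V n ⊆ O n) →
      ∃ y, IsSeqAccPoint V y) (H : Subgroup G) {F : Set (hO.CosetQuotient H)}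
    (hF : IsRPseudocompact F) : IsRPseudocompact (hO.proj H ⁻¹' F) := by
  intro γ hγ hγF
  let W := hγ.natEmbedding
  choose p hpW hpF using fun n => (hγF (W n) (W n).2).2
  obtain ⟨a, haF, ha⟩ := hF.exists_mapClusterPt hpF
  obtain ⟨p₀, rfl⟩ := hO.proj_surjective H a
  obtain ⟨g, rfl⟩ := QuotientGroup.mk_surjective p₀
  -- The `m`-th chosen member of `γ`, pulled back along `z ↦ z * g`, must meet `O m`.
  obtain ⟨φ, hφ, hφp⟩ := extraction_forall_of_frequently fun m =>
    (mapClusterPt_iff_frequently.1 ha _ (hO.eventually_of_proj_tendsto H g m)).mono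
      fun n hn => hn (p n) rfl
  choose x hxp hxO using fun m => mem_cosetEntourage_mk_right.1 (hφp m)
  have hVO : ∀ m, O m ∩ (fun z : G => ((z * g : G) : G ⧸ H)) ⁻¹' W (φ m) ⊆ O m :=
    fun m => inter_subset_left
  obtain ⟨y, hy⟩ := hacc (fun m => O m ∩ (fun z : G => ((z * g : G) : G ⧸ H)) ⁻¹' W (φ m))
    fun m => ⟨(hO.isOpen m).inter ((hγF _ (W (φ m)).2).1.preimage
      (QuotientGroup.continuous_mk.comp (continuous_mul_const g))),
      ⟨x m * g⁻¹, hxO m, by simpa [hxp] using hpW (φ m)⟩, hVO m⟩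
  have hyK := hO.mem_iInter_of_isSeqAccPoint hVO hy
  refine ⟨((y * g : G) : G ⧸ H), by rwa [mem_preimage, hO.proj_mul_left H hyK], fun N hN => ?_⟩
  have hN' : (fun z : G => ((z * g : G) : G ⧸ H)) ⁻¹' N ∈ 𝓝 y :=
    (QuotientGroup.continuous_mk.comp (continuous_mul_const g)).continuousAt.preimage_mem_nhds hN
  -- Distinct indices give distinct members of `γ`, so infinitely many indices yield infinitely many
  -- members.
  have hinj : Function.Injective fun m => (W (φ m) : Set (G ⧸ H)) :=
    Subtype.val_injective.comp (W.injective.comp hφ.injective)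
  refine ((hy _ hN').image hinj.injOn).mono ?_
  rintro _ ⟨m, ⟨z, hzN, -, hzW⟩, rfl⟩
  exact ⟨(W (φ m)).2, _, hzN, hzW⟩

end IsSquareRootSequence

theorem IsPseudocompactnessPoint.one {G : Type*} [Group G] [TopologicalSpace G]
    [IsTopologicalGroup G] {x : G} (hx : IsPseudocompactnessPoint x) :
    IsPseudocompactnessPoint (1 : G) := by
  obtain ⟨U, hU, hacc⟩ := hx
  refine ⟨fun n => (fun z => x * z) ⁻¹' U n, fun n =>
    ⟨(hU n).1.preimage (continuous_const_mul x), by simpa using (hU n).2⟩, fun V hV => ?_⟩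
  obtain ⟨y, hy⟩ := hacc (fun n => (fun z => x⁻¹ * z) ⁻¹' V n) fun n =>
    ⟨(hV n).1.preimage (continuous_const_mul _), by
      obtain ⟨v, hv⟩ := (hV n).2.1
      exact ⟨x * v, by simpa using hv⟩, fun z hz => by simpa using (hV n).2.2 hz⟩
  refine ⟨x⁻¹ * y, fun W hW => ?_⟩
  refine (hy _ ((continuous_const_mul x⁻¹).continuousAt.preimage_mem_nhds hW)).mono ?_
  rintro n ⟨w, hw, hwV⟩
  exact ⟨x⁻¹ * w, hw, hwV⟩

theorem theorem4p9 {G : Type u} [Group G] [TopologicalSpace G] [IsTopologicalGroup G] [T2Space G]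
    (hG : ∃ x : G, IsPseudocompactnessPoint x)
    (H : Subgroup G) (hH : IsClosed (H : Set G)) :
    ∃ (M : Type u) (_ : TopologicalSpace M) (f : G ⧸ H → M),
      TopologicalSpace.MetrizableSpace M ∧
      Continuous f ∧ IsOpenMap f ∧ Function.Surjective f ∧
      ∀ F : Set M, IsRPseudocompact F → IsRPseudocompact (f ⁻¹' F) := by
  obtain ⟨x, hx⟩ := hG
  obtain ⟨U, hU, hacc⟩ := hx.one
  obtain ⟨O, hO, hOU⟩ :=
    exists_isSquareRootSequence U fun n => (hU n).1.mem_nhds (hU n).2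
  have hacc' : ∀ V : ℕ → Set G, (∀ n, IsOpen (V n) ∧ (V n).Nonempty ∧ V n ⊆ O n) →
      ∃ y, IsSeqAccPoint V y := fun V hV =>
    hacc V fun n => ⟨(hV n).1, (hV n).2.1, (hV n).2.2.trans (hOU n)⟩
  exact ⟨hO.CosetQuotient H, inferInstance, hO.proj H, inferInstance, hO.continuous_proj H,
    hO.isOpenMap_proj hacc' H, hO.proj_surjective H,
    fun F hF => hO.isRPseudocompact_preimage_proj hacc' H hF⟩
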